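/- All systems are finite-dimensional with fixed orthonormal bases. Let $k\ge 1$ be an integer and let $\varepsilon\in[0,1-\frac{1}{k^2}]$. Let $A,B$ be systems of dimension $k$ and $A',B'$ systems of arbitrary dimension. A bipartite private state holding $\log_2 k$ key bits is a state $\gamma^k_{ABA'B'}=V(\Phi^k_{AB}\otimes\tau_{A'B'})V^\dagger$, where $\Phi^k=|\Phi^k\rangle\langle\Phi^k|$ with $|\Phi^k\rangle=\frac{1}{\sqrt k}\sum_{i=0}^{k-1}|i\rangle|i\rangle$, $\tau_{A'B'}$ is a state, and $V=\sum_{i=0}^{k-1}|i\rangle\langle i|_A\otimes I_B\otimes U^i_{A'B'}$ with unitaries $U^i$. The fidelity is $F(\rho,\sigma)=\big(\operatorname{Tr}\sqrt{\sqrt\sigma\,\rho\,\sqrt\sigma}\big)^2$. For a state $\rho_{XY}$ let $\mathcal F(\rho_{XY})$ be the set of all $\operatorname{Tr}_Y[\omega_{XYE}]$ (with $E$ identified with $Y$), where $E$ is a copy of $Y$ and $\omega_{XYE}$ is a state with $\operatorname{Tr}_E[\omega_{XYE}]=\rho_{XY}$. Let $$D^{\varepsilon}_{\min}(\rho\Vert\sigma)=-\log_2\inf_{0\le\Lambda\le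 I}\{\operatorname{Tr}[\Lambda\sigma]:\operatorname{Tr}[\Lambda\rho]\ge 1-\varepsilon\}\in\mathbb R\cup\{+\infty\},\qquad E^{u,\varepsilon}_{\min}(\rho_{XY})=\inf_{\sigma\in\mathcal F(\rho_{XY})}\tfrac12 D^{\varepsilon}_{\min}(\rho_{XY}\Vert\sigma).$$ If $\sigma_{ABA'B'}$ is a state with $F(\sigma_{ABA'B'},\gamma^k_{ABA'B'})\ge 1-\varepsilon$ for some bipartite private state $\gamma^k_{ABA'B'}$ holding $\log_2 k$ key bits, then its smooth-min unextendible entanglement with respect to the bipartition $X=AA'$, $Y=BB'$ satisfies $$E^{u,\varepsilon}_{\min}(\sigma_{ABA'B'})\ \ge\ -\tfrac12\log_2\varsigma(\varepsilon,k),\qquad \varsigma(\varepsilon,k)=\varepsilon+\frac{1-2\varepsilon}{k^2}+\frac{2\sqrt{(k^2-1)\,\varepsilon(1-\varepsilon)}}{k^2}.$$ -/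

import Mathlib

open scoped ENNReal Kronecker MatrixOrder ComplexOrder

namespace QuantumKey

noncomputable section

/-- A quantum state (density operator) of a finite-dimensional system with orthonormal basis
indexed by `n`. -/
def IsState {n : Type*} [Fintype n] (ρ : Matrix n n ℂ) : Prop :=
  ρ.PosSemidef ∧ ρ.trace = 1

/-- The fidelity `F(ρ, σ) = (Tr √(√σ ρ √σ))²`. The trace is that of a positive semidefinite
operator, hence a nonnegative real number. -/
def fidelity {n : Type*} [Fintype n] [DecidableEq n] (ρ σ : Matrix n n ℂ) : ℝ :=
  ((CFC.sqrt (CFC.sqrt σ * ρ * CFC.sqrt σ)).trace.re) ^ 2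

/-- The maximally entangled state vector `|Φ^k⟩ = (1/√k) ∑ᵢ |i⟩|i⟩`. -/
def maxEntangledVec (k : ℕ) : Fin k × Fin k → ℂ :=
  fun p => if p.1 = p.2 then ((1 / Real.sqrt k : ℝ) : ℂ) else 0

/-- The maximally entangled state `Φ^k = |Φ^k⟩⟨Φ^k|`. -/
def maxEntangled (k : ℕ) : Matrix (Fin k × Fin k) (Fin k × Fin k) ℂ :=
  Matrix.vecMulVec (maxEntangledVec k) (star (maxEntangledVec k))

/-- The twisting operator `V = ∑ᵢ |i⟩⟨i|_A ⊗ I_B ⊗ Uⁱ_{A'B'}`; systems are ordered `(A B) (A' B')`.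
-/
def twisting {k : ℕ} {s : Type*} [Fintype s] [DecidableEq s]
    (U : Fin k → Matrix.unitaryGroup s ℂ) :
    Matrix ((Fin k × Fin k) × s) ((Fin k × Fin k) × s) ℂ :=
  ∑ i : Fin k, (Matrix.single i i (1 : ℂ) ⊗ₖ (1 : Matrix (Fin k) (Fin k) ℂ)) ⊗ₖ
    (U i : Matrix s s ℂ)

/-- `γ` is a bipartite private state holding `log₂ k` secret key bits, with key systems `A`, `B`
of dimension `k` and shield systems `A'`, `B'`: it has the form
`V (Φ^k_{AB} ⊗ τ_{A'B'}) V†` for a state `τ` and a twisting unitary `V`. -/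
def IsPrivateState (k : ℕ) {a' b' : Type*} [Fintype a'] [DecidableEq a'] [Fintype b']
    [DecidableEq b']
    (γ : Matrix ((Fin k × Fin k) × (a' × b')) ((Fin k × Fin k) × (a' × b')) ℂ) : Prop :=
  ∃ (τ : Matrix (a' × b') (a' × b') ℂ) (U : Fin k → Matrix.unitaryGroup (a' × b') ℂ),
    IsState τ ∧
    γ = twisting U * (maxEntangled k ⊗ₖ τ) * (twisting U).conjTranspose

/-- The partial trace over the third system, `Tr_E ω_{ABE}`. -/
def traceE {a b : Type*} [Fintype b] (ω : Matrix ((a × b) × b) ((a × b) × b) ℂ) :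
    Matrix (a × b) (a × b) ℂ :=
  fun p q => ∑ e : b, ω (p, e) (q, e)

/-- The partial trace over the second system, `Tr_B ω_{ABE}`, where the remaining `E`, a copy of
`B`, takes the place of `B`. -/
def traceB {a b : Type*} [Fintype b] (ω : Matrix ((a × b) × b) ((a × b) × b) ℂ) :
    Matrix (a × b) (a × b) ℂ :=
  fun p q => ∑ y : b, ω ((p.1, y), p.2) ((q.1, y), q.2)

/-- The set of free states `𝓕(ρ_{AB})`: the marginals `Tr_B ω_{ABE}` of all state extensions
`ω_{ABE}` of `ρ_{AB}`, with `E` isomorphic to `B`. -/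
def freeStates {a b : Type*} [Fintype a] [Fintype b] (ρ : Matrix (a × b) (a × b) ℂ) :
    Set (Matrix (a × b) (a × b) ℂ) :=
  {σ | ∃ ω : Matrix ((a × b) × b) ((a × b) × b) ℂ,
    IsState ω ∧ traceE ω = ρ ∧ traceB ω = σ}

/-- The measurement operators `0 ≤ Λ ≤ I` with `Tr[Λ ρ] ≥ 1 - ε`. -/
def tests {n : Type*} [Fintype n] [DecidableEq n] (ε : ℝ) (ρ : Matrix n n ℂ) :
    Set (Matrix n n ℂ) :=
  {Λ | Λ.PosSemidef ∧ (1 - Λ).PosSemidef ∧ 1 - ε ≤ (Λ * ρ).trace.re}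

/-- The base-two logarithm `[0, ∞] → [-∞, ∞]`. -/
def log2 (x : ℝ≥0∞) : EReal :=
  ENNReal.log x / ((Real.log 2 : ℝ) : EReal)

/-- The smooth min-relative entropy (hypothesis testing relative entropy)
`D^ε_min(ρ‖σ) = -log₂ inf {Tr[Λ σ] : 0 ≤ Λ ≤ I, Tr[Λ ρ] ≥ 1 - ε}`, with value `+∞` if the infimum
is zero. -/
def smoothMinRelEntropy {n : Type*} [Fintype n] [DecidableEq n] (ε : ℝ) (ρ σ : Matrix n n ℂ) :
    EReal :=
  -log2 (⨅ Λ ∈ tests ε ρ, ENNReal.ofReal (Λ * σ).trace.re)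

/-- The smooth-min unextendible entanglement
`E^{u,ε}_min(ρ_{AB}) = inf_{σ ∈ 𝓕(ρ_{AB})} ½ D^ε_min(ρ_{AB}‖σ_{AB})`. -/
def smoothMinUnextEnt {a b : Type*} [Fintype a] [DecidableEq a] [Fintype b] [DecidableEq b]
    (ε : ℝ) (ρ : Matrix (a × b) (a × b) ℂ) : EReal :=
  ⨅ σ ∈ freeStates ρ, ((1 / 2 : ℝ) : EReal) * smoothMinRelEntropy ε ρ σ

/-- An operator on the systems `A B A' B'` viewed with respect to the bipartition `A A' : B B'`. -/
def aliceBob {a b a' b' : Type*}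
    (ρ : Matrix ((a × b) × (a' × b')) ((a × b) × (a' × b')) ℂ) :
    Matrix ((a × a') × (b × b')) ((a × a') × (b × b')) ℂ :=
  Matrix.reindex (Equiv.prodProdProdComm a b a' b') (Equiv.prodProdProdComm a b a' b') ρ

/-- `ς(ε, k) = ε + (1 - 2ε)/k² + 2√((k² - 1) ε (1 - ε))/k²`. -/
def varsigma (ε : ℝ) (k : ℕ) : ℝ :=
  ε + (1 - 2 * ε) / (k : ℝ) ^ 2 + 2 * Real.sqrt (((k : ℝ) ^ 2 - 1) * ε * (1 - ε)) / (k : ℝ) ^ 2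

end

end QuantumKey

/-! The privacy test `Λ = V (Φ ⊗ I) V†` is a projection fixing the private state, so `σ` passes it
with probability at least the fidelity, hence at least `1 - ε` (`fidelity_le_re_trace`). It is
therefore an admissible test, and it suffices to show that every free state passes it with
probability at most `ς`. A free state is the `XE` marginal of some `ω` whose `XY` marginal is `σ`,
so both probabilities are expectations in `ω`, of `P = Λ_XY ⊗ I_E` and `Q = Λ_XE ⊗ I_Y`. Monogamy
takes the exact form `Q P Q = k⁻² Q` (`actXE_mul_actXY_mul_actXE_privacyTest`): the ranges meet at
angle `arccos (1/k)`. If `Tr[P ω] ≥ 1 - ε`, the triangle inequality for angles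
(`re_trace_mul_le_of_projections`) gives `Tr[Q ω] ≤ cos² (arccos (1/k) - arccos √(1-ε))`, which is
`ς` (`varsigma_eq`). -/

namespace QuantumKey

/-! ### Two projections at a fixed angle -/

/-- The Cauchy–Schwarz inequality for the Frobenius inner product. -/
lemma re_trace_conjTranspose_mul_le {m n : Type*} [Fintype m] [Fintype n] (A B : Matrix m n ℂ) :
    (A.conjTranspose * B).trace.re ≤
      √(A.conjTranspose * A).trace.re * √(B.conjTranspose * B).trace.re := by
  have key : ∀ C D : Matrix m n ℂ, (C.conjTranspose * D).trace =
      inner ℂ (WithLp.toLp 2 (fun p : n × m => C p.2 p.1) : EuclideanSpace ℂ (n × m))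
        (WithLp.toLp 2 (fun p : n × m => D p.2 p.1)) := by
    intro C D
    simp [Matrix.trace, Matrix.mul_apply, PiLp.inner_apply, Fintype.sum_prod_type, mul_comm]
  have hn : ∀ C : Matrix m n ℂ, √(C.conjTranspose * C).trace.re =
      ‖(WithLp.toLp 2 (fun p : n × m => C p.2 p.1) : EuclideanSpace ℂ (n × m))‖ := by
    intro C
    rw [key, norm_eq_sqrt_re_inner (𝕜 := ℂ)]
    rfl
  rw [hn, hn, key]
  exact re_inner_le_norm (𝕜 := ℂ) _ _

lemma re_trace_conjTranspose_mul_self_nonneg {m n : Type*} [Fintype m] [Fintype n]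
    (A : Matrix m n ℂ) : 0 ≤ (A.conjTranspose * A).trace.re :=
  (Complex.le_def.1 (Matrix.posSemidef_conjTranspose_mul_self A).trace_nonneg).1

/-- If the angle between two unit vectors of the plane only shrinks, its cosine only grows. -/
lemma mul_add_sqrt_mul_sqrt_le {c a b : ℝ} (hc : 0 ≤ c) (hca : c ≤ a) (hab : a ≤ b) (hb : b ≤ 1) :
    c * b + √(1 - c ^ 2) * √(1 - b ^ 2) ≤ c * a + √(1 - c ^ 2) * √(1 - a ^ 2) := by
  have key : ∀ x, 0 ≤ x → x ≤ 1 →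
      c * x + √(1 - c ^ 2) * √(1 - x ^ 2) = Real.cos (Real.arccos c - Real.arccos x) := by
    intro x hx hx1
    rw [Real.cos_sub, Real.cos_arccos (by linarith) (by linarith),
      Real.cos_arccos (by linarith) hx1, Real.sin_arccos, Real.sin_arccos]
  rw [key b (by linarith) hb, key a (by linarith) (by linarith)]
  have h1 := Real.arccos_le_arccos hca
  have h2 := Real.arccos_le_arccos hab
  have h3 := Real.arccos_nonneg b
  have h4 := Real.arccos_le_pi c
  exact Real.cos_le_cos_of_nonneg_of_le_pi (by linarith) (by linarith) (by linarith)

/-- Two projections `P`, `Q` at angle `arccos c` cannot both be likely in the same state. -/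
lemma re_trace_mul_le_of_projections {n : Type*} [Fintype n] [DecidableEq n]
    {P Q ω : Matrix n n ℂ} (hω : IsState ω) (hP : P.IsHermitian) (hPP : P * P = P)
    (hQ : Q.IsHermitian) (hQQ : Q * Q = Q) {c a : ℝ} (hc : 0 ≤ c) (hca : c ≤ a)
    (hQPQ : Q * P * Q = ((c ^ 2 : ℝ) : ℂ) • Q) (ha : a ^ 2 ≤ (P * ω).trace.re) :
    (Q * ω).trace.re ≤ (c * a + √(1 - c ^ 2) * √(1 - a ^ 2)) ^ 2 := by
  -- With `ω = Bᴴ B`, the matrix `Bᴴ` serves as a purification: a unit vector for the Frobenius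
  -- inner product.
  obtain ⟨B, rfl⟩ :=
    CStarAlgebra.nonneg_iff_eq_star_mul_self.1 (Matrix.nonneg_iff_posSemidef.2 hω.1)
  rw [Matrix.star_eq_conjTranspose] at *
  have hP' : P.conjTranspose = P := hP
  have hQ' : Q.conjTranspose = Q := hQ
  set t := (Q * (B.conjTranspose * B)).trace.re with ht
  set p := (P * (B.conjTranspose * B)).trace.re with hp
  have hPc : (1 - P) * (1 - P) = 1 - P := IsIdempotentElem.one_sub hPP
  have htr : (B.conjTranspose * B).trace = 1 := hω.2
  have cyc : ∀ M : Matrix n n ℂ, (B * M * B.conjTranspose).trace =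
      (M * (B.conjTranspose * B)).trace := by
    intro M
    rw [Matrix.trace_mul_cycle, Matrix.trace_mul_comm]
  -- the Frobenius norms of the components of `X = Bᴴ` and `Y = Q Bᴴ` along `P` and `1 - P`
  have e1 : ((P * B.conjTranspose).conjTranspose * (P * B.conjTranspose)).trace.re = p := by
    rw [hp, ← cyc]
    simp only [Matrix.conjTranspose_mul, Matrix.conjTranspose_conjTranspose, hP']
    congr 2
    rw [← Matrix.mul_assoc, Matrix.mul_assoc B P P, hPP]
  have e2 : (((1 - P) * B.conjTranspose).conjTranspose * ((1 - P) * B.conjTranspose)).trace.re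
      = 1 - p := by
    have : ((1 - P) * B.conjTranspose).conjTranspose * ((1 - P) * B.conjTranspose) =
        B * (1 - P) * B.conjTranspose := by
      simp only [Matrix.conjTranspose_mul, Matrix.conjTranspose_conjTranspose,
        Matrix.conjTranspose_sub, Matrix.conjTranspose_one, hP']
      rw [← Matrix.mul_assoc, Matrix.mul_assoc B, hPc]
    rw [this, cyc, sub_mul, Matrix.trace_sub, one_mul, htr]
    simp [hp]
  have e3 : ((P * (Q * B.conjTranspose)).conjTranspose * (P * (Q * B.conjTranspose))).trace.re
      = c ^ 2 * t := by
    have : (P * (Q * B.conjTranspose)).conjTranspose * (P * (Q * B.conjTranspose)) =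
        B * (Q * P * Q) * B.conjTranspose := by
      simp only [Matrix.conjTranspose_mul, Matrix.conjTranspose_conjTranspose, hP', hQ']
      calc _ = B * Q * (P * P) * Q * B.conjTranspose := by simp only [Matrix.mul_assoc]
        _ = _ := by rw [hPP]; simp only [Matrix.mul_assoc]
    rw [this, cyc, hQPQ, Matrix.smul_mul, Matrix.trace_smul, smul_eq_mul, Complex.re_ofReal_mul]
  have e4 : (((1 - P) * (Q * B.conjTranspose)).conjTranspose *
      ((1 - P) * (Q * B.conjTranspose))).trace.re = (1 - c ^ 2) * t := by
    have : ((1 - P) * (Q * B.conjTranspose)).conjTranspose * ((1 - P) * (Q * B.conjTranspose)) =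
        B * (Q - Q * P * Q) * B.conjTranspose := by
      simp only [Matrix.conjTranspose_mul, Matrix.conjTranspose_conjTranspose, hP', hQ',
        Matrix.conjTranspose_sub, Matrix.conjTranspose_one]
      have : Q * ((1 - P) * (1 - P)) * Q = Q - Q * P * Q := by
        rw [hPc, mul_sub, sub_mul, mul_one, hQQ]
      rw [← this]
      simp only [Matrix.mul_assoc]
    rw [this, cyc, hQPQ, sub_mul, Matrix.trace_sub, Matrix.smul_mul, Matrix.trace_smul,
      smul_eq_mul, Complex.sub_re, Complex.re_ofReal_mul]
    ring
  have e5 : ((P * (Q * B.conjTranspose)).conjTranspose * (P * B.conjTranspose)).trace.re +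
      (((1 - P) * (Q * B.conjTranspose)).conjTranspose * ((1 - P) * B.conjTranspose)).trace.re
      = t := by
    rw [← Complex.add_re, ← Matrix.trace_add, ht, ← cyc]
    congr 2
    simp only [Matrix.conjTranspose_mul, Matrix.conjTranspose_conjTranspose, hP', hQ',
        Matrix.conjTranspose_sub, Matrix.conjTranspose_one]
    have : B * Q * (P * P + (1 - P) * (1 - P)) * B.conjTranspose = B * Q * B.conjTranspose := by
      have : P * P + (1 - P) * (1 - P) = 1 := by
        rw [hPP, hPc, add_sub_cancel]
      rw [this, mul_one]
    rw [← this]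
    simp only [Matrix.mul_assoc, Matrix.mul_add, Matrix.add_mul]
  have f0 : 0 ≤ t := by
    have := re_trace_conjTranspose_mul_self_nonneg (Q * B.conjTranspose)
    rwa [Matrix.conjTranspose_mul, Matrix.conjTranspose_conjTranspose, hQ', ← Matrix.mul_assoc,
      Matrix.mul_assoc B Q Q, hQQ, cyc] at this
  have f1 := re_trace_conjTranspose_mul_le (P * (Q * B.conjTranspose)) (P * B.conjTranspose)
  have f2 := re_trace_conjTranspose_mul_le ((1 - P) * (Q * B.conjTranspose))
    ((1 - P) * B.conjTranspose)
  rw [e3, e1] at f1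
  rw [e4, e2] at f2
  have f3 : 0 ≤ p := e1 ▸ re_trace_conjTranspose_mul_self_nonneg _
  have f4 : p ≤ 1 := by
    have := e2 ▸ re_trace_conjTranspose_mul_self_nonneg ((1 - P) * B.conjTranspose)
    linarith
  have hap : a ≤ √p := Real.le_sqrt_of_sq_le ha
  have hp1 : √p ≤ 1 := Real.sqrt_le_one.2 f4
  have hm := mul_add_sqrt_mul_sqrt_le hc hca hap hp1
  rw [Real.sq_sqrt f3] at hm
  have hc1 : 0 ≤ 1 - c ^ 2 := by nlinarith
  rw [Real.sqrt_mul (sq_nonneg c), Real.sqrt_sq hc] at f1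
  rw [Real.sqrt_mul hc1] at f2
  -- Cauchy–Schwarz on both components gives `t ≤ √t (c √p + √(1-c²) √(1-p))`; since `c ≤ a ≤ √p`,
  -- replacing `√p` by `a` only enlarges the bracket.
  have hr : √t * √t ≤ √t * (c * a + √(1 - c ^ 2) * √(1 - a ^ 2)) := by
    rw [Real.mul_self_sqrt f0]
    nlinarith [mul_le_mul_of_nonneg_left hm (Real.sqrt_nonneg t)]
  have ha0 : 0 ≤ a := hc.trans hca
  have hR : 0 ≤ c * a + √(1 - c ^ 2) * √(1 - a ^ 2) := by positivity
  rcases f0.eq_or_lt with h | h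
  · rw [← h]; positivity
  · have := le_of_mul_le_mul_left hr (Real.sqrt_pos.2 h)
    calc t = √t ^ 2 := (Real.sq_sqrt f0).symm
      _ ≤ _ := by gcongr

/-! ### Fidelity and projections -/

/-- A Hermitian pseudo-inverse of a Hermitian matrix. -/
lemma exists_pseudoinverse {n : Type*} [Fintype n] [DecidableEq n] {T : Matrix n n ℂ}
    (hT : T.IsHermitian) :
    ∃ R : Matrix n n ℂ, R.IsHermitian ∧ R * T * T = T ∧ T * R = R * T := by
  have hU : star (hT.eigenvectorUnitary : Matrix n n ℂ) * hT.eigenvectorUnitary = 1 :=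
    Unitary.coe_star_mul_self _
  have hs := hT.spectral_theorem
  set U : Matrix n n ℂ := Subtype.val hT.eigenvectorUnitary
  set d := hT.eigenvalues
  have hs' : T = U * Matrix.diagonal (fun i => (d i : ℂ)) * star U := hs
  have mulD : ∀ f g : n → ℂ, U * Matrix.diagonal f * star U * (U * Matrix.diagonal g * star U) =
      U * Matrix.diagonal (fun i => f i * g i) * star U := by
    intro f g
    calc _ = U * Matrix.diagonal f * (star U * U) * Matrix.diagonal g * star U := by
          simp only [Matrix.mul_assoc]
      _ = _ := by rw [hU, mul_one, Matrix.mul_assoc U, Matrix.diagonal_mul_diagonal]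
  -- The convention `0⁻¹ = 0` makes this the inverse on the range of `T` and zero on its kernel.
  refine ⟨U * Matrix.diagonal (fun i => ((d i)⁻¹ : ℂ)) * star U, ?_, ?_, ?_⟩
  · rw [Matrix.IsHermitian, Matrix.conjTranspose_mul, Matrix.conjTranspose_mul,
      Matrix.diagonal_conjTranspose, ← Matrix.star_eq_conjTranspose (star U), star_star,
      ← Matrix.star_eq_conjTranspose U, ← Matrix.mul_assoc]
    congr 3
    ext i
    simp
  · rw [hs', mulD, mulD]
    congr 3
    ext i
    by_cases h : d i = 0 <;> simp [h]
  · rw [hs', mulD, mulD]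
    congr 3
    ext i
    rw [mul_comm]

lemma sqrt_isHermitian {n : Type*} [Fintype n] [DecidableEq n] (M : Matrix n n ℂ) :
    (CFC.sqrt M).IsHermitian :=
  (Matrix.nonneg_iff_posSemidef.1 (CFC.sqrt_nonneg M)).1

lemma sqrt_mul_sqrt {n : Type*} [Fintype n] [DecidableEq n] {M : Matrix n n ℂ}
    (hM : M.PosSemidef) : CFC.sqrt M * CFC.sqrt M = M :=
  CFC.sqrt_mul_sqrt_self M (Matrix.nonneg_iff_posSemidef.2 hM)

/-- The fidelity to a state supported on a projection is at most the weight of that projection. -/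
lemma fidelity_le_re_trace {n : Type*} [Fintype n] [DecidableEq n] {σ γ Q : Matrix n n ℂ}
    (hσ : σ.PosSemidef) (hγ : IsState γ) (hQ : Q.IsHermitian) (hQQ : Q * Q = Q)
    (hQγ : Q * γ = γ) : fidelity σ γ ≤ (Q * σ).trace.re := by
  have hQ' : Q.conjTranspose = Q := hQ
  unfold fidelity
  set G := CFC.sqrt γ
  have hG : G.conjTranspose = G := sqrt_isHermitian γ
  have hGG : G * G = γ := sqrt_mul_sqrt hγ.1
  obtain ⟨S, hS⟩ :=
    CStarAlgebra.nonneg_iff_eq_star_mul_self.1 (Matrix.nonneg_iff_posSemidef.2 hσ)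
  rw [Matrix.star_eq_conjTranspose] at hS
  have hN : (G * σ * G).PosSemidef := by
    have := hσ.conjTranspose_mul_mul_same G
    rwa [hG] at this
  set T := CFC.sqrt (G * σ * G)
  have hT : T.conjTranspose = T := sqrt_isHermitian _
  have hTT : T * T = G * σ * G := sqrt_mul_sqrt hN
  -- Since `T² = (S G)ᴴ (S G)`, the matrix `S G R` is the partial isometry in the polar
  -- decomposition of `S G`.
  obtain ⟨R, hR, hRT, hcomm⟩ := exists_pseudoinverse (sqrt_isHermitian (G * σ * G))
  change R * T * T = T at hRT
  change T * R = R * T at hcomm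
  have hR' : R.conjTranspose = R := hR
  have hQG : Q * G = G := by
    have : ((1 - Q) * G) * ((1 - Q) * G).conjTranspose = 0 := by
      rw [Matrix.conjTranspose_mul, hG, ← Matrix.mul_assoc, Matrix.mul_assoc (1 - Q), hGG,
        sub_mul, hQγ]
      simp
    have := Matrix.self_mul_conjTranspose_eq_zero.1 this
    rw [sub_mul, one_mul, sub_eq_zero] at this
    exact this.symm
  -- `Tr T = Tr [(S G R G)ᴴ (S Q)]`
  have key : T.trace = ((S * G * R * G).conjTranspose * (S * Q)).trace := by
    simp only [Matrix.conjTranspose_mul, hG, hR']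
    calc T.trace = (R * (G * σ * (Q * G))).trace := by
          rw [hQG, ← hTT, ← Matrix.mul_assoc, hRT]
      _ = ((R * G * σ * Q) * G).trace := by simp only [Matrix.mul_assoc]
      _ = (G * (R * G * σ * Q)).trace := Matrix.trace_mul_comm _ _
      _ = _ := by rw [hS]; simp only [Matrix.mul_assoc]
  have hRTTR : R * T * (R * T) = R * T := by
    calc R * T * (R * T) = R * (T * R) * T := by simp only [Matrix.mul_assoc]
      _ = R * (R * T * T) := by rw [hcomm]; simp only [Matrix.mul_assoc]
      _ = _ := by rw [hRT]
  -- `R T` is the projection onto the range of `T`, so this norm is `Tr[G (R T) G] ≤ Tr γ = 1`.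
  have hA : ((S * G * R * G).conjTranspose * (S * G * R * G)).trace.re ≤ 1 := by
    have h1 : (S * G * R * G).conjTranspose * (S * G * R * G) = G * (R * T) * G := by
      simp only [Matrix.conjTranspose_mul, hG, hR']
      calc _ = G * R * (G * (S.conjTranspose * S) * G) * R * G := by simp only [Matrix.mul_assoc]
        _ = G * (R * T * (T * R)) * G := by rw [← hS, ← hTT]; simp only [Matrix.mul_assoc]
        _ = _ := by rw [hcomm, hRTTR]
    have hH : (R * T).conjTranspose = R * T := by rw [Matrix.conjTranspose_mul, hT, hR', hcomm]
    have h2 : ((1 - R * T) * G).conjTranspose * ((1 - R * T) * G) = γ - G * (R * T) * G := by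
      rw [Matrix.conjTranspose_mul, hG, Matrix.conjTranspose_sub, Matrix.conjTranspose_one, hH]
      calc _ = G * ((1 - R * T) * (1 - R * T)) * G := by simp only [Matrix.mul_assoc]
        _ = G * (1 - R * T) * G := by
          rw [(IsIdempotentElem.one_sub hRTTR : (1 - R * T) * (1 - R * T) = 1 - R * T)]
        _ = _ := by rw [mul_sub, sub_mul, mul_one, hGG]
    have h3 := re_trace_conjTranspose_mul_self_nonneg ((1 - R * T) * G)
    rw [h2, Matrix.trace_sub, hγ.2, Complex.sub_re, Complex.one_re] at h3
    rw [h1]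
    linarith
  have hB : ((S * Q).conjTranspose * (S * Q)).trace = (Q * σ).trace := by
    rw [Matrix.conjTranspose_mul, hQ']
    calc _ = ((Q * S.conjTranspose * S) * Q).trace := by simp only [Matrix.mul_assoc]
      _ = (Q * (Q * S.conjTranspose * S)).trace := Matrix.trace_mul_comm _ _
      _ = ((Q * Q) * (S.conjTranspose * S)).trace := by simp only [Matrix.mul_assoc]
      _ = _ := by rw [hQQ, hS]
  have h0 : 0 ≤ T.trace.re := (Complex.le_def.1
    (Matrix.nonneg_iff_posSemidef.1 (CFC.sqrt_nonneg (G * σ * G))).trace_nonneg).1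
  have hcs := re_trace_conjTranspose_mul_le (S * G * R * G) (S * Q)
  rw [← key, hB] at hcs
  have hq : 0 ≤ (Q * σ).trace.re := hB ▸ re_trace_conjTranspose_mul_self_nonneg (S * Q)
  have : T.trace.re ≤ √(Q * σ).trace.re :=
    hcs.trans (mul_le_of_le_one_left (Real.sqrt_nonneg _) (Real.sqrt_le_one.2 hA))
  calc T.trace.re ^ 2 ≤ √(Q * σ).trace.re ^ 2 := by gcongr
    _ = _ := Real.sq_sqrt hq

/-! ### The maximally entangled state and the privacy test -/

lemma isHermitian_maxEntangled (k : ℕ) : (maxEntangled k).conjTranspose = maxEntangled k := by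
  rw [maxEntangled, Matrix.conjTranspose_vecMulVec, star_star]

lemma maxEntangledVec_dotProduct {k : ℕ} (hk : 1 ≤ k) :
    star (maxEntangledVec k) ⬝ᵥ maxEntangledVec k = 1 := by
  have hk' : (k : ℂ) ≠ 0 := by exact_mod_cast (by omega : k ≠ 0)
  have : ((√(k : ℝ) : ℝ) : ℂ) * (√(k : ℝ) : ℝ) = k := by
    rw [← Complex.ofReal_mul, Real.mul_self_sqrt (Nat.cast_nonneg k), Complex.ofReal_natCast]
  simp [dotProduct, maxEntangledVec, Fintype.sum_prod_type, apply_ite]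
  rw [← mul_inv, this, mul_inv_cancel₀ hk']

lemma maxEntangled_mul_self {k : ℕ} (hk : 1 ≤ k) :
    maxEntangled k * maxEntangled k = maxEntangled k := by
  rw [maxEntangled, Matrix.vecMulVec_mul_vecMulVec, maxEntangledVec_dotProduct hk, one_smul]

lemma maxEntangled_apply (k : ℕ) (p q : Fin k × Fin k) :
    maxEntangled k p q = if p.1 = p.2 ∧ q.1 = q.2 then (k : ℂ)⁻¹ else 0 := by
  have : ((√(k : ℝ) : ℝ) : ℂ) * (√(k : ℝ) : ℝ) = k := by
    rw [← Complex.ofReal_mul, Real.mul_self_sqrt (Nat.cast_nonneg k), Complex.ofReal_natCast]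
  by_cases h : p.1 = p.2 <;> by_cases h' : q.1 = q.2 <;>
    simp [maxEntangled, Matrix.vecMulVec_apply, maxEntangledVec, h, h', ← mul_inv, this]

lemma trace_maxEntangled {k : ℕ} (hk : 1 ≤ k) : (maxEntangled k).trace = 1 := by
  rw [maxEntangled, Matrix.trace_vecMulVec, dotProduct_comm, maxEntangledVec_dotProduct hk]

section

variable {k : ℕ} {s : Type*} [Fintype s] [DecidableEq s] (U : Fin k → Matrix.unitaryGroup s ℂ)

lemma twisting_apply (i j i' j' : Fin k) (x x' : s) :
    twisting U ((i, j), x) ((i', j'), x') =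
      if i = i' ∧ j = j' then (U i : Matrix s s ℂ) x x' else 0 := by
  simp only [twisting, Matrix.sum_apply, Matrix.kroneckerMap_apply, Matrix.one_apply,
    Matrix.single_apply]
  rw [Finset.sum_eq_single i]
  · by_cases h : i = i' <;> by_cases h' : j = j' <;> simp [h, h']
  · intro b _ hb
    simp [hb]
  · simp

lemma conjTranspose_twisting_mul : (twisting U).conjTranspose * twisting U = 1 := by
  have hU : ∀ i, (U i : Matrix s s ℂ).conjTranspose * U i = 1 :=
    fun i => Unitary.coe_star_mul_self (U i)
  ext ⟨⟨i, j⟩, x⟩ ⟨⟨i', j'⟩, x'⟩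
  have := congrFun (congrFun (hU i) x) x'
  simp only [Matrix.mul_apply, Matrix.conjTranspose_apply, Matrix.one_apply] at this
  simp only [Matrix.mul_apply, Matrix.conjTranspose_apply, Matrix.one_apply, twisting_apply,
    Fintype.sum_prod_type]
  rw [Finset.sum_eq_single i, Finset.sum_eq_single j]
  · by_cases h : i = i' <;> by_cases h' : j = j' <;> simp [h, h']
    subst h
    exact this
  · intro b _ hb
    simp [hb]
  · simp
  · intro b _ hb
    simp [hb]
  · simp

/-- The privacy test `V (Φ^k_{AB} ⊗ I_{A'B'}) V†`. -/
noncomputable def privacyTest : Matrix ((Fin k × Fin k) × s) ((Fin k × Fin k) × s) ℂ :=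
  twisting U * (maxEntangled k ⊗ₖ (1 : Matrix s s ℂ)) * (twisting U).conjTranspose

lemma privacyTest_isHermitian : (privacyTest U).IsHermitian := by
  rw [Matrix.IsHermitian, privacyTest, Matrix.conjTranspose_mul, Matrix.conjTranspose_mul,
    Matrix.conjTranspose_conjTranspose, Matrix.conjTranspose_kronecker, isHermitian_maxEntangled,
    Matrix.conjTranspose_one, Matrix.mul_assoc]

lemma twisting_conj_mul (M N : Matrix ((Fin k × Fin k) × s) ((Fin k × Fin k) × s) ℂ) :
    (twisting U * M * (twisting U).conjTranspose) * (twisting U * N * (twisting U).conjTranspose) =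
      twisting U * (M * N) * (twisting U).conjTranspose := by
  calc _ = twisting U * M * ((twisting U).conjTranspose * twisting U) * N *
        (twisting U).conjTranspose := by simp only [Matrix.mul_assoc]
    _ = _ := by rw [conjTranspose_twisting_mul, mul_one]; simp only [Matrix.mul_assoc]

lemma privacyTest_mul_self (hk : 1 ≤ k) : privacyTest U * privacyTest U = privacyTest U := by
  rw [privacyTest, twisting_conj_mul, ← Matrix.mul_kronecker_mul, maxEntangled_mul_self hk,
    mul_one]

lemma privacyTest_mul_privateState (hk : 1 ≤ k) (τ : Matrix s s ℂ) :
    privacyTest U * (twisting U * (maxEntangled k ⊗ₖ τ) * (twisting U).conjTranspose) =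
      twisting U * (maxEntangled k ⊗ₖ τ) * (twisting U).conjTranspose := by
  rw [privacyTest, twisting_conj_mul, ← Matrix.mul_kronecker_mul, maxEntangled_mul_self hk,
    one_mul]

lemma isState_privateState (hk : 1 ≤ k) {τ : Matrix s s ℂ} (hτ : IsState τ) :
    IsState (twisting U * (maxEntangled k ⊗ₖ τ) * (twisting U).conjTranspose) := by
  constructor
  · exact ((Matrix.posSemidef_vecMulVec_self_star _).kronecker hτ.1).mul_mul_conjTranspose_same _
  · rw [Matrix.trace_mul_cycle, conjTranspose_twisting_mul, one_mul, Matrix.trace_kronecker,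
      trace_maxEntangled hk, hτ.2, one_mul]

lemma privacyTest_apply (i j i' j' : Fin k) (x x' : s) :
    privacyTest U ((i, j), x) ((i', j'), x') =
      if i = j ∧ i' = j' then
        (k : ℂ)⁻¹ * ((U i : Matrix s s ℂ) * (U i' : Matrix s s ℂ).conjTranspose) x x'
      else 0 := by
  have h1 : ∀ y, (twisting U * (maxEntangled k ⊗ₖ (1 : Matrix s s ℂ))) ((i, j), x) y =
      if i = j ∧ y.1.1 = y.1.2 then (k : ℂ)⁻¹ * (U i : Matrix s s ℂ) x y.2 else 0 := by
    rintro ⟨⟨a, b⟩, y⟩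
    simp only [Matrix.mul_apply, twisting_apply, Fintype.sum_prod_type, Matrix.kroneckerMap_apply,
      maxEntangled_apply, Matrix.one_apply]
    rw [Finset.sum_eq_single i, Finset.sum_eq_single j]
    · by_cases h : i = j <;> by_cases h' : a = b <;> simp [h, h', mul_comm]
    · intro b _ hb
      simp [hb.symm]
    · simp
    · intro b _ hb
      simp [hb.symm]
    · simp
  simp only [privacyTest, Matrix.mul_apply (M := twisting U * _), h1, Matrix.conjTranspose_apply,
    Fintype.sum_prod_type, twisting_apply]
  rw [Finset.sum_eq_single i', Finset.sum_eq_single j']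
  · by_cases h : i = j <;> by_cases h' : i' = j' <;>
      simp [h, h', Matrix.mul_apply, Finset.mul_sum, mul_assoc]
  · intro b _ hb
    simp [hb.symm]
  · simp
  · intro b _ hb
    simp [hb.symm]
  · simp

end

/-! ### Operators on the extended system -/

lemma aliceBob_mul {a b a' b' : Type*} [Fintype a] [Fintype b] [Fintype a'] [Fintype b']
    (M N : Matrix ((a × b) × (a' × b')) ((a × b) × (a' × b')) ℂ) :
    aliceBob (M * N) = aliceBob M * aliceBob N := by
  simp [aliceBob, Matrix.submatrix_mul_equiv]

lemma trace_aliceBob {a b a' b' : Type*} [Fintype a] [Fintype b] [Fintype a'] [Fintype b']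
    (M : Matrix ((a × b) × (a' × b')) ((a × b) × (a' × b')) ℂ) :
    (aliceBob M).trace = M.trace := by
  simp only [aliceBob, Matrix.trace, Matrix.diag, Matrix.reindex_apply, Matrix.submatrix_apply]
  exact Equiv.sum_comp (Equiv.prodProdProdComm a b a' b').symm fun x => M x x

/-- `M_{XY} ⊗ I_E`. -/
def actXY {X Y : Type*} [DecidableEq Y] (M : Matrix (X × Y) (X × Y) ℂ) :
    Matrix ((X × Y) × Y) ((X × Y) × Y) ℂ :=
  M ⊗ₖ (1 : Matrix Y Y ℂ)

/-- The exchange of `Y` and its copy `E`. -/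
def swapYE (X Y : Type*) : (X × Y) × Y ≃ (X × Y) × Y where
  toFun p := ((p.1.1, p.2), p.1.2)
  invFun p := ((p.1.1, p.2), p.1.2)
  left_inv _ := rfl
  right_inv _ := rfl

/-- `M_{XE} ⊗ I_Y`, where `E` is a copy of `Y`. -/
def actXE {X Y : Type*} [DecidableEq Y] (M : Matrix (X × Y) (X × Y) ℂ) :
    Matrix ((X × Y) × Y) ((X × Y) × Y) ℂ :=
  (actXY M).submatrix (swapYE X Y) (swapYE X Y)

section

variable {X Y : Type*} [DecidableEq Y]

lemma actXY_conjTranspose (M : Matrix (X × Y) (X × Y) ℂ) :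
    actXY M.conjTranspose = (actXY M).conjTranspose := by
  rw [actXY, actXY, Matrix.conjTranspose_kronecker, Matrix.conjTranspose_one]

lemma actXE_conjTranspose (M : Matrix (X × Y) (X × Y) ℂ) :
    actXE M.conjTranspose = (actXE M).conjTranspose := by
  rw [actXE, actXE, actXY_conjTranspose, Matrix.conjTranspose_submatrix]

lemma actXY_one [DecidableEq X] : actXY (1 : Matrix (X × Y) (X × Y) ℂ) = 1 := by
  rw [actXY, Matrix.one_kronecker_one]

lemma actXE_one [DecidableEq X] : actXE (1 : Matrix (X × Y) (X × Y) ℂ) = 1 := by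
  rw [actXE, actXY_one, Matrix.submatrix_one_equiv]

variable [Fintype X] [Fintype Y]

lemma actXY_mul (M N : Matrix (X × Y) (X × Y) ℂ) : actXY (M * N) = actXY M * actXY N := by
  rw [actXY, actXY, actXY, ← Matrix.mul_kronecker_mul, one_mul]

lemma actXE_mul (M N : Matrix (X × Y) (X × Y) ℂ) : actXE (M * N) = actXE M * actXE N := by
  rw [actXE, actXE, actXE, actXY_mul, Matrix.submatrix_mul_equiv]

/-- Lifts an expectation from a marginal to the extension, so that tests on `XY` and on `XE` can be
compared in one state. -/
lemma trace_actXY_mul (M : Matrix (X × Y) (X × Y) ℂ)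
    (ω : Matrix ((X × Y) × Y) ((X × Y) × Y) ℂ) :
    (actXY M * ω).trace = (M * traceE ω).trace := by
  simp only [Matrix.trace, Matrix.diag, Matrix.mul_apply, actXY, Matrix.kroneckerMap_apply,
    traceE, Matrix.one_apply]
  rw [Fintype.sum_prod_type]
  refine Finset.sum_congr rfl fun p _ => ?_
  simp only [Fintype.sum_prod_type (α₁ := X × Y) (α₂ := Y), mul_ite, mul_one, mul_zero, ite_mul,
    zero_mul, Finset.sum_ite_eq, Finset.mem_univ, if_true, Finset.mul_sum]
  exact Finset.sum_comm

lemma trace_actXE_mul (M : Matrix (X × Y) (X × Y) ℂ)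
    (ω : Matrix ((X × Y) × Y) ((X × Y) × Y) ℂ) :
    (actXE M * ω).trace = (M * traceB ω).trace := by
  have h : traceB ω = traceE (ω.submatrix (swapYE X Y) (swapYE X Y)) := rfl
  rw [h, ← trace_actXY_mul]
  have h' : actXE M * ω = (actXY M * ω.submatrix (swapYE X Y) (swapYE X Y)).submatrix
      (swapYE X Y) (swapYE X Y) := by
    rw [← Matrix.submatrix_mul_equiv _ _ _ (swapYE X Y)]
    rfl
  rw [h']
  exact Equiv.sum_comp (swapYE X Y)
    fun x => (actXY M * ω.submatrix (swapYE X Y) (swapYE X Y)) x x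

end

/-! ### Monogamy of the privacy test -/

section

variable {k : ℕ} {R : Type*} [Ring R] [StarRing R] [Algebra ℂ R]

/-- The block matrix `∑ |iil⟩⟨jjl| ⊗ uᵢ uⱼ† / k`. -/
noncomputable def blockAB (u : Fin k → R) :
    Matrix ((Fin k × Fin k) × Fin k) ((Fin k × Fin k) × Fin k) R :=
  fun p q => if (p.1.1 = p.1.2 ∧ q.1.1 = q.1.2) ∧ p.2 = q.2 then
    (k : ℂ)⁻¹ • (u p.1.1 * star (u q.1.1)) else 0

/-- The block matrix `∑ |ili⟩⟨jlj| ⊗ vᵢ vⱼ† / k`. -/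
noncomputable def blockAE (v : Fin k → R) :
    Matrix ((Fin k × Fin k) × Fin k) ((Fin k × Fin k) × Fin k) R :=
  fun p q => if (p.1.1 = p.2 ∧ q.1.1 = q.2) ∧ p.1.2 = q.1.2 then
    (k : ℂ)⁻¹ • (v p.1.1 * star (v q.1.1)) else 0

/-- In each product the key indices leave a single summand, the one where all three equal the key
index of `B`. The surviving coefficient is `vᵢ vⱼ† uⱼ uⱼ† vⱼ vₘ† = vᵢ vₘ†`, with weight `k⁻³`.
Unitarity alone cancels the middle factors: `u` and `v` act on different shields and need not
commute. -/
lemma blockAE_mul_blockAB_mul_blockAE (u v : Fin k → R) (hu : ∀ i, u i * star (u i) = 1)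
    (hv : ∀ i, star (v i) * v i = 1) :
    blockAE v * blockAB u * blockAE v = ((k : ℂ)⁻¹ ^ 2) • blockAE v := by
  have h1 : ∀ p q, (blockAE v * blockAB u) p q =
      if p.1.1 = p.2 ∧ q.1.1 = q.1.2 ∧ p.1.2 = q.2 then
        ((k : ℂ)⁻¹ ^ 2) • (v p.1.1 * star (v p.1.2) * (u p.1.2 * star (u q.1.1))) else 0 := by
    rintro ⟨⟨i, j⟩, l⟩ ⟨⟨i', j'⟩, l'⟩
    simp only [Matrix.mul_apply, Fintype.sum_prod_type, blockAE, blockAB]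
    rw [Finset.sum_eq_single j, Finset.sum_eq_single j, Finset.sum_eq_single j]
    · by_cases h : i = l <;> by_cases h' : i' = j' <;> by_cases h'' : j = l' <;>
        simp [h, h', h'', smul_smul, sq]
    · intro b _ hb
      simp [hb.symm]
    · simp
    · intro b _ hb
      simp [hb.symm]
    · simp
    · intro b _ hb
      refine Finset.sum_eq_zero fun c _ => Finset.sum_eq_zero fun d _ => ?_
      by_cases h : b = c
      · subst h
        simp [hb.symm]
      · simp [h]
    · simp
  ext ⟨⟨i, j⟩, l⟩ ⟨⟨i', j'⟩, l'⟩
  rw [Matrix.mul_apply]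
  simp only [h1, Fintype.sum_prod_type]
  rw [Finset.sum_eq_single j, Finset.sum_eq_single j, Finset.sum_eq_single j]
  · have huv : v i * star (v j) * (u j * star (u j)) * (v j * star (v i')) = v i * star (v i') := by
      rw [hu, mul_one, mul_assoc, ← mul_assoc (star (v j)), hv, one_mul]
    simp only [blockAE, Matrix.smul_apply]
    by_cases h : (i = l ∧ i' = l') ∧ j = j'
    · obtain ⟨⟨rfl, rfl⟩, rfl⟩ := h
      simp only [and_self, if_true]
      rw [smul_mul_assoc, mul_smul_comm, huv]
    · rw [if_neg h, smul_zero]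
      by_cases h1 : i = l
      · by_cases h2 : i' = l'
        · have h3 : j ≠ j' := fun h3 => h ⟨⟨h1, h2⟩, h3⟩
          simp [h3]
        · simp [h2]
      · simp [h1]
  · intro b _ hb
    simp [hb.symm]
  · simp
  · intro b _ hb
    simp [hb.symm]
  · simp
  · intro b _ hb
    refine Finset.sum_eq_zero fun c _ => Finset.sum_eq_zero fun d _ => ?_
    by_cases h : j = d
    · subst h
      simp [blockAE, hb]
    · simp [h]
  · simp

end

section

variable {a' b' : Type*} [Fintype a'] [DecidableEq a'] [Fintype b'] [DecidableEq b'] {k : ℕ}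

/-- The reordering of `A A' B B' E E'` as `A B E A' B' E'`. -/
def keyShieldEquiv (k : ℕ) (a' b' : Type*) : ((Fin k × a') × (Fin k × b')) × (Fin k × b') ≃
    ((Fin k × Fin k) × Fin k) × ((a' × b') × b') :=
  ((Equiv.prodProdProdComm (Fin k) a' (Fin k) b').prodCongr (Equiv.refl _)).trans
    (Equiv.prodProdProdComm (Fin k × Fin k) (a' × b') (Fin k) b')

/-- Grouping keys outside and shields inside turns the test into a block matrix over the operators
on `A' B' E'`; the test on `AE` uses the same reordering, so the two can be multiplied blockwise. -/
lemma actXY_aliceBob_privacyTest (U : Fin k → Matrix.unitaryGroup (a' × b') ℂ) :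
    actXY (aliceBob (privacyTest U)) =
      (Matrix.comp _ _ _ _ ℂ
        (blockAB fun i => actXY (U i : Matrix (a' × b') (a' × b') ℂ))).submatrix
        (keyShieldEquiv k a' b') (keyShieldEquiv k a' b') := by
  ext ⟨⟨⟨i, x⟩, ⟨j, y⟩⟩, ⟨l, z⟩⟩ ⟨⟨⟨i', x'⟩, ⟨j', y'⟩⟩, ⟨l', z'⟩⟩
  have h : privacyTest U ((i, j), (x, y)) ((i', j'), (x', y')) = _ :=
    privacyTest_apply U _ _ _ _ _ _
  simp only [keyShieldEquiv, Matrix.submatrix_apply, Equiv.trans_apply, Equiv.prodCongr_apply,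
    Equiv.prodProdProdComm_apply, Matrix.comp_apply, Prod.map_apply, Equiv.refl_apply, blockAB,
    Matrix.star_eq_conjTranspose, ← actXY_conjTranspose, ← actXY_mul]
  change privacyTest U ((i, j), (x, y)) ((i', j'), (x', y')) *
    (1 : Matrix (Fin k × b') (Fin k × b') ℂ) (l, z) (l', z') = _
  rw [h]
  by_cases h1 : i = j ∧ i' = j' <;> by_cases h2 : l = l' <;>
    simp [h1, h2, Matrix.one_apply, actXY, Matrix.kroneckerMap_apply]

lemma actXE_aliceBob_privacyTest (U : Fin k → Matrix.unitaryGroup (a' × b') ℂ) :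
    actXE (aliceBob (privacyTest U)) =
      (Matrix.comp _ _ _ _ ℂ
        (blockAE fun i => actXE (U i : Matrix (a' × b') (a' × b') ℂ))).submatrix
        (keyShieldEquiv k a' b') (keyShieldEquiv k a' b') := by
  rw [actXE, actXY_aliceBob_privacyTest]
  ext ⟨⟨⟨i, x⟩, ⟨j, y⟩⟩, ⟨l, z⟩⟩ ⟨⟨⟨i', x'⟩, ⟨j', y'⟩⟩, ⟨l', z'⟩⟩
  simp only [keyShieldEquiv, Matrix.submatrix_apply, Equiv.trans_apply, Equiv.prodCongr_apply,
    Equiv.prodProdProdComm_apply, Matrix.comp_apply, Prod.map_apply, Equiv.refl_apply, blockAB,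
    blockAE, Matrix.star_eq_conjTranspose, ← actXY_conjTranspose, ← actXY_mul,
    ← actXE_conjTranspose, ← actXE_mul, swapYE, Equiv.coe_fn_mk]
  by_cases h1 : i = l ∧ i' = l' <;> by_cases h2 : j = j' <;>
    simp [h1, h2, actXE, swapYE]

/-- The privacy tests on `AB` and on `AE` are projections at angle `arccos (1 / k)`. -/
lemma actXE_mul_actXY_mul_actXE_privacyTest (U : Fin k → Matrix.unitaryGroup (a' × b') ℂ) :
    actXE (aliceBob (privacyTest U)) * actXY (aliceBob (privacyTest U)) *
        actXE (aliceBob (privacyTest U)) =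
      ((k : ℂ)⁻¹ ^ 2) • actXE (aliceBob (privacyTest U)) := by
  have hU : ∀ i, (U i : Matrix (a' × b') (a' × b') ℂ) *
      (U i : Matrix (a' × b') (a' × b') ℂ).conjTranspose = 1 :=
    fun i => Unitary.coe_mul_star_self (U i)
  have hU' : ∀ i, (U i : Matrix (a' × b') (a' × b') ℂ).conjTranspose *
      (U i : Matrix (a' × b') (a' × b') ℂ) = 1 :=
    fun i => Unitary.coe_star_mul_self (U i)
  have h := blockAE_mul_blockAB_mul_blockAE
    (fun i => actXY (U i : Matrix (a' × b') (a' × b') ℂ))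
    (fun i => actXE (U i : Matrix (a' × b') (a' × b') ℂ))
    (fun i => by rw [Matrix.star_eq_conjTranspose, ← actXY_conjTranspose, ← actXY_mul, hU,
      actXY_one])
    (fun i => by rw [Matrix.star_eq_conjTranspose, ← actXE_conjTranspose, ← actXE_mul, hU',
      actXE_one])
  -- Flattening block matrices is a ring isomorphism, so the block identity transfers to scalar
  -- matrices.
  have h' := congrArg (Matrix.compRingEquiv _ _ ℂ) h
  rw [map_mul, map_mul] at h'
  simp only [Matrix.compRingEquiv_apply] at h'
  rw [actXY_aliceBob_privacyTest, actXE_aliceBob_privacyTest, Matrix.submatrix_mul_equiv,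
    Matrix.submatrix_mul_equiv, h']
  rfl

end

/-! ### Closed form of the bound and conclusion -/

lemma isHermitian_aliceBob {a b a' b' : Type*}
    {M : Matrix ((a × b) × (a' × b')) ((a × b) × (a' × b')) ℂ} (hM : M.IsHermitian) :
    (aliceBob M).IsHermitian :=
  hM.submatrix _

lemma posSemidef_of_projection {n : Type*} [Fintype n] {P : Matrix n n ℂ} (hP : P.IsHermitian)
    (hPP : P * P = P) : P.PosSemidef := by
  have := Matrix.posSemidef_conjTranspose_mul_self P
  rwa [hP.eq, hPP] at this

/-- Expanding the square of `cos (arccos (1/k) - arccos √(1-ε))` gives `ς`. -/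
lemma varsigma_eq {k : ℕ} (hk : 1 ≤ k) {ε : ℝ} (hε₀ : 0 ≤ ε) (hε₁ : ε ≤ 1) :
    varsigma ε k = ((k : ℝ)⁻¹ * √(1 - ε) + √(1 - (k : ℝ)⁻¹ ^ 2) * √(1 - √(1 - ε) ^ 2)) ^ 2 := by
  have hk' : (1 : ℝ) ≤ k := by exact_mod_cast hk
  have hk0 : (0 : ℝ) < k := by linarith
  have e1 : 1 - (k : ℝ)⁻¹ ^ 2 = ((k : ℝ) ^ 2 - 1) / k ^ 2 := by field_simp
  have hk2 : 0 ≤ (k : ℝ) ^ 2 - 1 := by nlinarith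
  rw [Real.sq_sqrt (by linarith), e1, Real.sqrt_div hk2, Real.sqrt_sq hk0.le, varsigma,
    Real.sqrt_mul (mul_nonneg hk2 hε₀), Real.sqrt_mul hk2]
  have s1 := Real.sq_sqrt hk2
  have s2 := Real.sq_sqrt hε₀
  have s3 := Real.sq_sqrt (sub_nonneg.2 hε₁)
  rw [sub_sub_cancel]
  set A := √((k : ℝ) ^ 2 - 1)
  set B := √ε
  set C := √(1 - ε)
  have : ((k : ℝ)⁻¹ * C + A / k * B) ^ 2 = (C ^ 2 + A ^ 2 * B ^ 2 + 2 * (A * B * C)) / k ^ 2 := by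
    field_simp
    ring
  rw [this, s1, s2, s3]
  field_simp
  ring

lemma log2_mono : Monotone log2 := fun _ _ h =>
  EReal.div_le_div_right_of_nonneg (by exact_mod_cast (Real.log_nonneg one_le_two))
    (ENNReal.log_monotone h)

lemma log2_ofReal {x : ℝ} (hx : 0 < x) : log2 (ENNReal.ofReal x) = (Real.logb 2 x : ℝ) := by
  rw [log2, ENNReal.log_ofReal_of_pos hx, Real.logb, EReal.coe_div]

end QuantumKey

theorem proposition4 {a' b' : Type*} [Fintype a'] [DecidableEq a'] [Fintype b'] [DecidableEq b']
    (k : ℕ) (hk : 1 ≤ k) (ε : ℝ) (hε₀ : 0 ≤ ε) (hε₁ : ε ≤ 1 - 1 / (k : ℝ) ^ 2)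
    (σ γ : Matrix ((Fin k × Fin k) × (a' × b')) ((Fin k × Fin k) × (a' × b')) ℂ)
    (hσ : QuantumKey.IsState σ) (hγ : QuantumKey.IsPrivateState k γ)
    (hF : 1 - ε ≤ QuantumKey.fidelity σ γ) :
    ((-(1 / 2) * Real.logb 2 (QuantumKey.varsigma ε k) : ℝ) : EReal) ≤
      QuantumKey.smoothMinUnextEnt ε (QuantumKey.aliceBob σ) := by
  open QuantumKey in
  obtain ⟨τ, U, hτ, rfl⟩ := hγ
  have hk0 : (0 : ℝ) < k := by exact_mod_cast hk
  have hinv : (0 : ℝ) < 1 / (k : ℝ) ^ 2 := by positivity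
  have hε : ε ≤ 1 := by linarith
  set Λ := privacyTest U
  have hΛ : Λ.IsHermitian := privacyTest_isHermitian U
  have hΛΛ : Λ * Λ = Λ := privacyTest_mul_self U hk
  have hB : (aliceBob Λ).IsHermitian := isHermitian_aliceBob hΛ
  have hBB : aliceBob Λ * aliceBob Λ = aliceBob Λ := by rw [← aliceBob_mul, hΛΛ]
  have hpass : 1 - ε ≤ (aliceBob Λ * aliceBob σ).trace.re := by
    rw [← aliceBob_mul, trace_aliceBob]
    exact hF.trans (fidelity_le_re_trace hσ.1 (isState_privateState U hk hτ) hΛ hΛΛ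
      (privacyTest_mul_privateState U hk τ))
  -- Positivity makes the logarithm of the bound a finite real; it uses `ε < 1`, which follows from
  -- `ε ≤ 1 - 1/k²`.
  have hpos : 0 < varsigma ε k := by
    rw [varsigma_eq hk hε₀ hε]
    have : 0 < √(1 - ε) := Real.sqrt_pos.2 (by linarith)
    positivity
  refine le_iInf₂ fun σ' hσ' => ?_
  obtain ⟨ω, hω, hωE, hωB⟩ := hσ'
  have hbound : (aliceBob Λ * σ').trace.re ≤ varsigma ε k := by
    rw [varsigma_eq hk hε₀ hε, ← hωB, ← trace_actXE_mul]
    refine re_trace_mul_le_of_projections (P := actXY (aliceBob Λ)) hω ?_ ?_ ?_ ?_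
      (by positivity) ?_ ?_ ?_
    · rw [Matrix.IsHermitian, ← actXY_conjTranspose, hB.eq]
    · rw [← actXY_mul, hBB]
    · rw [Matrix.IsHermitian, ← actXE_conjTranspose, hB.eq]
    · rw [← actXE_mul, hBB]
    -- The hypothesis `ε ≤ 1 - 1/k²` is exactly `1/k ≤ √(1-ε)`, the regime where the angle bound is
    -- monotone.
    · refine Real.le_sqrt_of_sq_le ?_
      rw [inv_pow, ← one_div]
      linarith
    · rw [actXE_mul_actXY_mul_actXE_privacyTest]
      push_cast
      rfl
    · rw [Real.sq_sqrt (by linarith), trace_actXY_mul, hωE]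
      exact hpass
  have hmem : aliceBob Λ ∈ tests ε (aliceBob σ) :=
    ⟨posSemidef_of_projection hB hBB, posSemidef_of_projection (Matrix.isHermitian_one.sub hB)
      (IsIdempotentElem.one_sub hBB), hpass⟩
  have hinf : log2 (⨅ Λ ∈ tests ε (aliceBob σ), ENNReal.ofReal (Λ * σ').trace.re) ≤
      (Real.logb 2 (varsigma ε k) : ℝ) := by
    rw [← log2_ofReal hpos]
    exact log2_mono ((iInf₂_le _ hmem).trans (ENNReal.ofReal_le_ofReal hbound))
  rw [neg_mul, ← mul_neg, EReal.coe_mul, EReal.coe_neg]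
  exact mul_le_mul_of_nonneg_left (EReal.neg_le_neg_iff.2 hinf) (by exact_mod_cast (by norm_num))
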